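/- Let $k\ge 2$, let $n_1\ge n_2\ge\dots\ge n_k\ge 2$ be integers, and write $x_j=(x_{j,1},\dots,x_{j,n_j})$ for the coordinates on $\mathbb C^{n_j}$. A polynomial $F\in\mathbb C[x_1,\dots,x_k]$ on $\mathbb C^{n_1}\times\dots\times\mathbb C^{n_k}$ is called *Cartesian* if there are non-constant polynomials $G_j\in\mathbb C[x_j]$ and polynomials $H_j\in\mathbb C[x_1,\dots,x_k]$ ($j=1,\dots,k$) such that $$F=\sum_{j=1}^k G_j(x_j)\,H_j(x_1,\dots,x_k),$$ and *non-Cartesian* otherwise. A property is said to hold for a *generic polynomial of degree $d$* if there is a non-empty Zariski-open subset of the finite-dimensional complex vector space of polynomials in $\mathbb C[x_1,\dots,x_k]$ of total degree at most $d$ such that every polynomial in this subset has the property. 1. If $n_1\ge k$ and $d\ge 2$, then a generic polynomial of degree $d$ on $\mathbb C^{n_1}\times\dots\times\mathbb C^{n_k}$ is non-Cartesian. 2. If $d\ge\max\{2k-3,7\}$, then a generic polynomial of degree $d$ on $\mathbb C^{n_1}\times\dots\times\mathbb C^{n_k}$ is non-Cartesian. -/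

import Mathlib

/-- A polynomial on `ℂ^{n 0} × ⋯ × ℂ^{n (k-1)}` is a polynomial in the variables `x_{j,i}`,
indexed by the pairs `⟨j, i⟩` with `j : Fin k` (the block) and `i : Fin (n j)`. -/
abbrev BlockPolynomial {k : ℕ} (n : Fin k → ℕ) : Type :=
  MvPolynomial (Σ j : Fin k, Fin (n j)) ℂ

/-- `F` is Cartesian with respect to the product decomposition `ℂ^{n 0} × ⋯ × ℂ^{n (k-1)}`:
it can be written as `F = ∑ j, G_j(x_j) H_j(x_0, …, x_{k-1})`, where each `G_j` is a non-constant
polynomial in the variables of the `j`-th block alone and the `H_j` are arbitrary. -/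
def IsCartesian {k : ℕ} {n : Fin k → ℕ} (F : BlockPolynomial n) : Prop :=
  ∃ (G : ∀ j : Fin k, MvPolynomial (Fin (n j)) ℂ) (H : Fin k → BlockPolynomial n),
    (∀ j, ∀ c : ℂ, G j ≠ MvPolynomial.C c) ∧
    F = ∑ j, MvPolynomial.rename (Sigma.mk j) (G j) * H j

/-- Zariski-open subsets of the affine space `ι → ℂ`: complements of zero loci. -/
def IsZariskiOpen {ι : Type*} (U : Set (ι → ℂ)) : Prop :=
  ∃ I : Ideal (MvPolynomial ι ℂ), U = (MvPolynomial.zeroLocus ℂ I)ᶜ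

/-- The coefficients of `F` at the monomials of degree at most `d`. On polynomials of degree at
most `d` this is the standard identification of that vector space with an affine space. -/
def coeffVector {σ : Type*} (d : ℕ) (F : MvPolynomial σ ℂ) :
    {m : σ →₀ ℕ // m.degree ≤ d} → ℂ :=
  fun m => F.coeff m.1

/-- A (Zariski) generic polynomial of degree `d` satisfies `P`: there is a nonempty Zariski-open
subset of the affine space of polynomials of degree at most `d` on which `P` holds. As that space
is irreducible, such a subset is automatically dense. -/
def GenericPolynomialSatisfies {σ : Type*} (d : ℕ) (P : MvPolynomial σ ℂ → Prop) : Prop :=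
  ∃ U : Set ({m : σ →₀ ℕ // m.degree ≤ d} → ℂ), IsZariskiOpen U ∧ U.Nonempty ∧
    ∀ F : MvPolynomial σ ℂ, F.totalDegree ≤ d → coeffVector d F ∈ U → P F

namespace MvPolynomial

open Polynomial (natDegree)

/-! ### Restriction to parametrized lines, and a dimension count in coefficient space. -/

section General

variable {σ : Type*} {K R : Type*} [CommRing K] [CommRing R] [Algebra K R]

/-! Let `F = ∑ G_j H_j` have degree `d ≥ 2` and top form `T`. Putting zeros of the other `G_i` into
their blocks makes `F` divisible by `G_j`. If the pure power `x_{j,i}^d` occurs in `F`, then `G_j`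
is monic in `x_{j,i}` up to a scalar, so a zero exists with all other coordinates of the block
prescribed (`exists_update_root`).

Take two blocks and a coordinate plane in each. On the plane in block `j`, the leading form of `G_j`
has a zero `(α, 1)`, where `T` vanishes too. Let `(β(s), s)` be zeros of `G_{j'}` in the other
plane. The restrictions of `F` to block `j` over `s` and over `0` are both divisible by `G_j`, and
so is their difference, in which `T` cancels. In degree `d - 1` this gives `(β(s) - β(0)) ∂₀T + s
∂₁T = 0` at `(α, 1)`, with the derivatives taken along block `j'`. Either `∂₀T` vanishes there, or
`β` is affine of some slope `δ`; then `F` vanishes on a line and `T` vanishes at `(δ, 1)`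
(`IsCartesian.exists_slopes`).

The first case is two conditions with one parameter, the second three with two. By elimination
(`exists_ne_zero_eval_coeffVector_eq_zero`) each confines the coefficients of `F` to a proper
hypersurface. Both parts of the theorem lie in the range `d ≥ 2`. -/

theorem induction_on_totalDegree_le {P : MvPolynomial σ K → Prop} {n : ℕ} (zero : P 0)
    (add : ∀ p q, P p → P q → P (p + q))
    (mono : ∀ m c, Finsupp.degree m ≤ n → P (monomial m c))
    (F : MvPolynomial σ K) (hF : F.totalDegree ≤ n) : P F := by
  rw [F.as_sum]
  refine Finset.sum_induction _ P add zero fun m hm => mono m _ ?_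
  refine le_trans ?_ hF
  exact le_totalDegree hm

/-- Substitution of the parametrized line `T ↦ b + T a`. -/
noncomputable def alongLine (K : Type*) [CommRing K] [Algebra K R] (a b : σ → R) :
    MvPolynomial σ K →ₐ[K] Polynomial R :=
  aeval fun i => Polynomial.C (b i) + Polynomial.C (a i) * Polynomial.X

@[simp]
theorem alongLine_X (a b : σ → R) (i : σ) :
    alongLine K a b (X i) = Polynomial.C (b i) + Polynomial.C (a i) * Polynomial.X :=
  aeval_X _ _

theorem eval_alongLine (a b : σ → R) (t : R) (F : MvPolynomial σ K) :
    (alongLine K a b F).eval t = aeval (fun i => b i + a i * t) F := by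
  induction F using MvPolynomial.induction_on with
  | C c =>
    rw [← algebraMap_eq, AlgHom.commutes, AlgHom.commutes, Polynomial.algebraMap_apply,
      Polynomial.eval_C]
  | add p q hp hq => simp [hp, hq]
  | mul_X p i hp => simp [hp]

theorem map_alongLine {S : Type*} [CommRing S] [Algebra K S] (f : R →ₐ[K] S) (a b : σ → R)
    (F : MvPolynomial σ K) :
    (alongLine K a b F).map (f : R →+* S) = alongLine K (fun i => f (a i)) (fun i => f (b i)) F := by
  induction F using MvPolynomial.induction_on with
  | C c =>
    rw [← algebraMap_eq, AlgHom.commutes, AlgHom.commutes, Polynomial.algebraMap_apply,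
      Polynomial.map_C, Polynomial.algebraMap_apply]
    simp
  | add p q hp hq => simp [hp, hq]
  | mul_X p i hp => simp [hp]

/-- Induction on the number of variable factors; the degree `k` is carried existentially and is
identified with `m.degree` afterwards, when `c ≠ 0`. -/
theorem alongLine_homogeneous_monomial [Fintype σ] (a b : σ → R) (m : σ →₀ ℕ) (c : K) :
    ∃ k, (monomial m c).IsHomogeneous k ∧ natDegree (alongLine K a b (monomial m c)) ≤ k ∧
      (alongLine K a b (monomial m c)).coeff k = aeval a (monomial m c) ∧
      ∀ n, n + 1 = k → (alongLine K a b (monomial m c)).coeff n =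
        ∑ i, b i * aeval a (pderiv i (monomial m c)) := by
  classical
  refine induction_on_monomial (motive := fun p => ∃ k, p.IsHomogeneous k ∧
    natDegree (alongLine K a b p) ≤ k ∧ (alongLine K a b p).coeff k = aeval a p ∧
      ∀ n, n + 1 = k → (alongLine K a b p).coeff n = ∑ i, b i * aeval a (pderiv i p)) ?_ ?_ m c
  · intro c
    refine ⟨0, isHomogeneous_C _ _, ?_, ?_, fun n hn => by omega⟩
    · rw [← algebraMap_eq, AlgHom.commutes, Polynomial.algebraMap_apply, Polynomial.natDegree_C]
    · rw [← algebraMap_eq, AlgHom.commutes, AlgHom.commutes, Polynomial.algebraMap_apply,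
        Polynomial.coeff_C_zero]
  · rintro p j ⟨k, hk, hdeg, htop, hsub⟩
    have hX : natDegree (Polynomial.C (b j) + Polynomial.C (a j) * Polynomial.X) ≤ 1 := by
      rw [add_comm]; exact Polynomial.natDegree_linear_le
    have hz : (alongLine K a b p).coeff (k + 1) = 0 :=
      Polynomial.coeff_eq_zero_of_natDegree_lt (by omega)
    have hcoeff : ∀ n, (alongLine K a b (p * X j)).coeff (n + 1) =
        (alongLine K a b p).coeff (n + 1) * b j + (alongLine K a b p).coeff n * a j := by
      intro n
      rw [map_mul, alongLine_X, mul_add, Polynomial.coeff_add, Polynomial.coeff_mul_C,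
        ← mul_assoc, Polynomial.coeff_mul_X, Polynomial.coeff_mul_C]
    refine ⟨k + 1, hk.mul (isHomogeneous_X _ _), ?_, ?_, ?_⟩
    · rw [map_mul, alongLine_X]
      exact Polynomial.natDegree_mul_le_of_le hdeg hX
    · rw [hcoeff, hz, htop, map_mul, aeval_X, zero_mul, zero_add]
    · intro n hn
      obtain rfl : n = k := by omega
      have hd : ∑ i, b i * aeval a (pderiv i (p * X j)) =
          aeval a p * b j + (∑ i, b i * aeval a (pderiv i p)) * a j := by
        have : ∀ i, b i * aeval a (pderiv i (p * X j)) =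
            b i * aeval a (pderiv i p) * a j + if i = j then aeval a p * b i else 0 := by
          intro i
          rw [pderiv_mul, pderiv_X]
          by_cases h : i = j
          · subst h; simp; ring
          · simp [h]; ring
        simp_rw [this, Finset.sum_add_distrib, Finset.sum_mul]
        rw [add_comm]
        simp
      rw [hd]
      -- If `p` has degree 0 there is no coefficient below its top one; `p` is then constant and the
      -- derivative term vanishes.
      cases n with
      | zero =>
        have : ∀ i, pderiv i p = 0 := by
          intro i
          rw [show p = C (coeff 0 p) from totalDegree_eq_zero_iff_eq_C.1
            (Nat.le_zero.1 hk.totalDegree_le), pderiv_C]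
        simp [this, ← htop, mul_add, ← mul_assoc, Polynomial.mul_coeff_zero]
      | succ n => rw [hcoeff, htop, hsub n rfl]

theorem alongLine_monomial [Fintype σ] (a b : σ → R) (m : σ →₀ ℕ) (c : K) :
    natDegree (alongLine K a b (monomial m c)) ≤ m.degree ∧
      (alongLine K a b (monomial m c)).coeff m.degree = aeval a (monomial m c) ∧
      ∀ n, n + 1 = m.degree → (alongLine K a b (monomial m c)).coeff n =
        ∑ i, b i * aeval a (pderiv i (monomial m c)) := by
  by_cases hc : c = 0
  · simp [hc]
  obtain ⟨k, hk, h⟩ := alongLine_homogeneous_monomial a b m c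
  obtain rfl : k = m.degree :=
    hk.inj_right (isHomogeneous_monomial c rfl) (by simpa using hc)
  exact h

theorem homogeneousComponent_monomial_self (m : σ →₀ ℕ) (c : K) {n : ℕ} (h : m.degree = n) :
    homogeneousComponent n (monomial m c) = monomial m c :=
  homogeneousComponent_of_mem (isHomogeneous_monomial c h) |>.trans (if_pos rfl)

theorem homogeneousComponent_monomial_of_ne (m : σ →₀ ℕ) (c : K) {n : ℕ} (h : m.degree ≠ n) :
    homogeneousComponent n (monomial m c) = 0 :=
  homogeneousComponent_of_mem (isHomogeneous_monomial c rfl) |>.trans (if_neg h.symm)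

theorem natDegree_alongLine_le [Fintype σ] (a b : σ → R) {n : ℕ} {F : MvPolynomial σ K}
    (hF : F.totalDegree ≤ n) : natDegree (alongLine K a b F) ≤ n := by
  refine induction_on_totalDegree_le (P := fun F => natDegree (alongLine K a b F) ≤ n) (by simp)
    (fun p q hp hq => by rw [map_add]; exact Polynomial.natDegree_add_le_of_degree_le hp hq) ?_ F hF
  exact fun m c hm => (alongLine_monomial a b m c).1.trans hm

theorem coeff_alongLine [Fintype σ] (a b : σ → R) {n : ℕ} {F : MvPolynomial σ K}
    (hF : F.totalDegree ≤ n) :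
    (alongLine K a b F).coeff n = aeval a (homogeneousComponent n F) := by
  refine induction_on_totalDegree_le (P := fun F => (alongLine K a b F).coeff n =
    aeval a (homogeneousComponent n F)) (by simp) (fun p q hp hq => by simp [hp, hq]) ?_ F hF
  intro m c hm
  obtain ⟨h1, h2, -⟩ := alongLine_monomial a b m c
  rcases hm.eq_or_lt with rfl | h
  · rw [h2, homogeneousComponent_monomial_self _ _ rfl]
  · rw [homogeneousComponent_monomial_of_ne _ _ h.ne,
      Polynomial.coeff_eq_zero_of_natDegree_lt (by omega), map_zero]

/-- First-order Taylor expansion at `T a`: the base point `b` enters only through a directional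
derivative of the top form. -/
theorem coeff_alongLine_of_succ [Fintype σ] (a b : σ → R) {n : ℕ} {F : MvPolynomial σ K}
    (hF : F.totalDegree ≤ n + 1) :
    (alongLine K a b F).coeff n = aeval a (homogeneousComponent n F) +
      ∑ i, b i * aeval a (pderiv i (homogeneousComponent (n + 1) F)) := by
  refine induction_on_totalDegree_le (P := fun F => (alongLine K a b F).coeff n =
    aeval a (homogeneousComponent n F) +
      ∑ i, b i * aeval a (pderiv i (homogeneousComponent (n + 1) F))) (by simp)
      (fun p q hp hq => ?_) ?_ F hF
  · simp only [map_add, Polynomial.coeff_add, hp, hq, mul_add, Finset.sum_add_distrib]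
    ring
  intro m c hm
  obtain ⟨h1, h2, h3⟩ := alongLine_monomial a b m c
  rcases hm.eq_or_lt with h | h
  · rw [h3 n h.symm, homogeneousComponent_monomial_self _ _ h,
      homogeneousComponent_monomial_of_ne _ _ (by omega), map_zero, zero_add]
  · rw [homogeneousComponent_monomial_of_ne (n := n + 1) _ _ h.ne]
    simp only [map_zero, mul_zero, Finset.sum_const_zero, add_zero]
    exact coeff_alongLine a b ((totalDegree_monomial_le m c).trans (by
      rw [Finsupp.degree_apply] at h; exact Nat.lt_succ_iff.1 h))

end General

/-- If finitely many linear conditions on the coefficients of polynomials of degree at most `d`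
can be solved for distinct coefficients and depend polynomially on fewer parameters than there are
conditions, then the polynomials satisfying them for some value of the parameters lie in a proper
hypersurface. -/
theorem exists_ne_zero_eval_coeffVector_eq_zero {σ τ ι : Type} [Finite σ] [Fintype τ] [Fintype ι]
    [DecidableEq ι] (d : ℕ) (hcard : Fintype.card τ < Fintype.card ι)
    (Λ : ι → MvPolynomial σ ℂ →ₗ[ℂ] MvPolynomial τ ℂ) (μ : ι → σ →₀ ℕ)
    (hμ : ∀ s, (μ s).degree ≤ d)
    (hΛ : ∀ s s', Λ s (monomial (μ s') 1) = if s = s' then 1 else 0) :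
    ∃ R : MvPolynomial {m : σ →₀ ℕ // m.degree ≤ d} ℂ, R ≠ 0 ∧
      ∀ F : MvPolynomial σ ℂ, F.totalDegree ≤ d →
        ∀ t : τ → ℂ, (∀ s, eval t (Λ s F) = 0) → eval (coeffVector d F) R = 0 := by
  classical
  have : Finite {m : σ →₀ ℕ // m.degree ≤ d} := (Finsupp.finite_of_degree_le d).to_subtype
  have := Fintype.ofFinite {m : σ →₀ ℕ // m.degree ≤ d}
  have hinj : Function.Injective fun s => (⟨μ s, hμ s⟩ : {m : σ →₀ ℕ // m.degree ≤ d}) := by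
    intro s s' h
    have h : μ s = μ s' := congrArg Subtype.val h
    by_contra hne
    have h1 := hΛ s s'
    rw [← h, hΛ s s, if_pos rfl, if_neg hne] at h1
    exact one_ne_zero h1
  set e : ι → {m : σ →₀ ℕ // m.degree ≤ d} := fun s => ⟨μ s, hμ s⟩ with he
  let N := {m : {m : σ →₀ ℕ // m.degree ≤ d} // m ∉ Set.range e}
  -- Parametrizes the coefficient vectors satisfying the conditions: the coefficients off `μ` and
  -- the parameters `τ` are free, and the `s`-th condition is solved for the coefficient at `μ s`.
  let y : {m : σ →₀ ℕ // m.degree ≤ d} → MvPolynomial (N ⊕ τ) ℂ := fun m =>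
    if h : ∃ s, e s = m then
      -∑ m' : N, X (Sum.inl m') * rename Sum.inr (Λ h.choose (monomial m'.1.1 1))
    else X (Sum.inl ⟨m, h⟩)
  -- There are fewer free variables than coefficients, so the parametrization satisfies an algebraic
  -- relation `R`.
  have hdep : ¬ AlgebraicIndependent ℂ y := by
    intro h
    have hle := h.cardinalMk_le_trdeg
    rw [MvPolynomial.trdeg_of_isDomain, Cardinal.lift_id, Cardinal.mk_fintype, Cardinal.mk_fintype,
      Nat.cast_le, Fintype.card_sum] at hle
    have h1 : Fintype.card N = Fintype.card {m : σ →₀ ℕ // m.degree ≤ d} -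
        Fintype.card (Set.range e) := Fintype.card_compl_set (Set.range e)
    have h2 : Fintype.card (Set.range e) = Fintype.card ι := Set.card_range_of_injective hinj
    have h3 := Fintype.card_le_of_injective e hinj
    omega
  rw [algebraicIndependent_iff] at hdep
  push Not at hdep
  obtain ⟨R, hR, hR0⟩ := hdep
  refine ⟨R, hR0, fun F hF t ht => ?_⟩
  have hFsum : F = ∑ m : {m : σ →₀ ℕ // m.degree ≤ d}, coeffVector d F m • monomial m.1 1 := by
    ext m
    simp only [coeff_sum, coeff_smul, coeff_monomial, smul_eq_mul, mul_ite, mul_one, mul_zero]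
    by_cases hm : m.degree ≤ d
    · rw [Finset.sum_eq_single ⟨m, hm⟩ (fun b _ hb => if_neg fun h => hb (Subtype.ext h))
        (by simp)]
      simp [coeffVector]
    · rw [Finset.sum_eq_zero fun b _ => if_neg fun h : b.1 = m => hm (h ▸ b.2)]
      exact coeff_eq_zero_of_totalDegree_lt (by
        rw [Finsupp.degree_apply] at hm; exact hF.trans_lt (not_le.1 hm))
  have hev : ∀ s, ∑ m : {m : σ →₀ ℕ // m.degree ≤ d},
      coeffVector d F m * eval t (Λ s (monomial m.1 1)) = 0 := by
    intro s
    rw [← ht s]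
    conv_rhs => rw [hFsum]
    simp [smul_eval]
  have hsolve : ∀ s, coeffVector d F (e s) =
      -∑ m' : N, coeffVector d F m'.1 * eval t (Λ s (monomial m'.1.1 1)) := by
    intro s
    have h := hev s
    rw [← Fintype.sum_subtype_add_sum_subtype (fun m => m ∉ Set.range e)] at h
    have h2 : ∑ m : {m // ¬ m ∉ Set.range e},
        coeffVector d F m.1 * eval t (Λ s (monomial m.1.1 1)) = coeffVector d F (e s) := by
      rw [Finset.sum_eq_single ⟨e s, not_not.2 ⟨s, rfl⟩⟩]
      · simp [he, hΛ]
      · rintro ⟨m, hm⟩ - hne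
        obtain ⟨s', rfl⟩ := not_not.1 hm
        have : s ≠ s' := by rintro rfl; exact hne rfl
        simp [he, hΛ, this]
      · simp
    rw [h2] at h
    exact eq_neg_of_add_eq_zero_right h
  have hy : ∀ m, eval (Sum.elim (fun m' : N => coeffVector d F m'.1) t) (y m) =
      coeffVector d F m := by
    intro m
    by_cases h : ∃ s, e s = m
    · simp only [y, dif_pos h]
      refine Eq.trans ?_ ((hsolve h.choose).symm.trans (congrArg _ h.choose_spec))
      simp [eval_rename]
    · simp [y, dif_neg h]
  have h := congrArg (eval (Sum.elim (fun m' : N => coeffVector d F m'.1) t)) hR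
  rw [map_zero, map_aeval] at h
  simp only [hy] at h
  rw [← h, eval]
  congr 2
  ext
  simp

end MvPolynomial

/-! ### Zeros of non-constant polynomials, pure powers and slope vectors. -/

namespace MvPolynomial

open Polynomial (natDegree)

/-- Nullstellensatz: without zeros, `G` generates the unit ideal and is a constant. -/
theorem exists_eval_eq_zero {σ : Type*} [Finite σ] {G : MvPolynomial σ ℂ}
    (hG : ∀ c, G ≠ C c) : ∃ z, eval z G = 0 := by
  by_contra! h
  have hempty : zeroLocus ℂ (Ideal.span {G}) = ∅ := by
    refine Set.eq_empty_of_forall_notMem fun z hz => h z ?_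
    have := hz G (Ideal.mem_span_singleton_self G)
    rwa [aeval_eq_eval] at this
  have hrad := vanishingIdeal_zeroLocus_eq_radical (k := ℂ) (K := ℂ) (Ideal.span {G})
  rw [hempty, vanishingIdeal_empty, eq_comm, Ideal.radical_eq_top,
    Ideal.span_singleton_eq_top] at hrad
  obtain ⟨c, -, hc⟩ := isUnit_iff_eq_C_of_isReduced.1 hrad
  exact hG c hc

theorem aeval_homogeneousComponent_single {σ R : Type*} [CommRing R] [Algebra ℂ R]
    (a : σ → R) (x : σ) (hx : a x = 1) (h0 : ∀ y ≠ x, a y = 0) (d : ℕ) (F : MvPolynomial σ ℂ) :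
    aeval a (homogeneousComponent d F) = algebraMap ℂ R (coeff (Finsupp.single x d) F) := by
  classical
  induction F using MvPolynomial.induction_on' with
  | add p q hp hq => simp [hp, hq]
  | monomial m c =>
    by_cases hm : m.degree = d
    · rw [homogeneousComponent_monomial_self _ _ hm, aeval_monomial, coeff_monomial]
      split_ifs with h
      · simp [h, Finsupp.prod_single_index, hx]
      · obtain ⟨y, hy, hmy⟩ : ∃ y ≠ x, m y ≠ 0 := by
          by_contra! hcon
          refine h ?_
          have hm' : m = Finsupp.single x (m x) := by
            ext y
            by_cases hy : y = x
            · simp [hy]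
            · rw [hcon y hy, Finsupp.single_eq_of_ne hy]
          rw [hm', Finsupp.degree_single] at hm
          rw [hm', hm]
        rw [Finsupp.prod, Finset.prod_eq_zero (i := y) (Finsupp.mem_support_iff.2 hmy)
          (by rw [h0 y hy, zero_pow hmy]), mul_zero, map_zero]
    · rw [homogeneousComponent_monomial_of_ne _ _ hm, coeff_monomial, if_neg, map_zero, map_zero]
      rintro rfl
      exact hm (Finsupp.degree_single _ _)

theorem alongLine_zero {σ K R : Type*} [CommRing K] [CommRing R] [Algebra K R] (b : σ → R)
    (F : MvPolynomial σ K) : alongLine K 0 b F = Polynomial.C (aeval b F) := by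
  induction F using MvPolynomial.induction_on with
  | C c =>
    rw [← algebraMap_eq, AlgHom.commutes, AlgHom.commutes, Polynomial.algebraMap_apply]
  | add p q hp hq => simp [hp, hq]
  | mul_X p i hp => simp [hp]

/-- Each factor `T` brings exactly one coordinate of `a`, which has degree at most 1. -/
theorem natDegree_coeff_alongLine_le {σ : Type*} (a : σ → Polynomial ℂ) (b : σ → ℂ)
    (ha : ∀ i, (a i).natDegree ≤ 1) (F : MvPolynomial σ ℂ) (m : ℕ) :
    ((alongLine ℂ a (fun i => Polynomial.C (b i)) F).coeff m).natDegree ≤ m := by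
  induction F using MvPolynomial.induction_on generalizing m with
  | C c =>
    rw [← algebraMap_eq, AlgHom.commutes, Polynomial.algebraMap_apply, Polynomial.coeff_C]
    split_ifs <;> simp
  | add p q hp hq =>
    rw [map_add, Polynomial.coeff_add]
    exact Polynomial.natDegree_add_le_of_degree_le (hp m) (hq m)
  | mul_X p i hp =>
    rw [map_mul, alongLine_X, mul_add, Polynomial.coeff_add, Polynomial.coeff_mul_C, ← mul_assoc]
    refine Polynomial.natDegree_add_le_of_degree_le ?_ ?_
    · exact (Polynomial.natDegree_mul_C_le _ _).trans (hp m)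
    · cases m with
      | zero => simp
      | succ m =>
        rw [Polynomial.coeff_mul_X, Polynomial.coeff_mul_C]
        exact Polynomial.natDegree_mul_le_of_le (hp m) (ha i)

/-- The vector with coordinate `r` at `p`, coordinate `1` at `q`, and all others zero. -/
def slopeVector {σ R : Type*} [DecidableEq σ] [AddMonoid R] [One R] (p q : σ) (r : R) : σ → R :=
  Pi.single p r + Pi.single q 1

theorem aeval_slopeVector_X {σ : Type*} [DecidableEq σ] (p q : σ) (F : MvPolynomial σ ℂ) :
    aeval (slopeVector p q (Polynomial.X : Polynomial ℂ)) F =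
      alongLine ℂ (Pi.single p 1) (Pi.single q 1) F := by
  rw [alongLine]
  congr 2
  ext1 i
  simp only [slopeVector, Pi.add_apply, Pi.single_apply]
  split_ifs <;> simp [add_comm]

theorem eval_aeval_slopeVector_X {σ : Type*} [DecidableEq σ] (p q : σ) (α : ℂ)
    (F : MvPolynomial σ ℂ) :
    (aeval (slopeVector p q (Polynomial.X : Polynomial ℂ)) F).eval α =
      eval (slopeVector p q α) F := by
  rw [aeval_slopeVector_X, eval_alongLine, ← aeval_eq_eval]
  congr 2
  ext1 i
  simp only [slopeVector, Pi.add_apply, Pi.single_apply]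
  split_ifs <;> simp [add_comm]

end MvPolynomial

/-! ### Leading coefficients of divisors. -/

namespace Polynomial

theorem leadingCoeff_dvd_coeff {R : Type*} [CommRing R] [IsDomain R] {P D : Polynomial R} {m : ℕ}
    (h : P ∣ D) (hD : D.natDegree ≤ m) : P.leadingCoeff ∣ D.coeff m := by
  rcases hD.eq_or_lt with rfl | hlt
  · obtain ⟨Q, rfl⟩ := h
    exact ⟨Q.leadingCoeff, leadingCoeff_mul P Q⟩
  · rw [coeff_eq_zero_of_natDegree_lt hlt]
    exact dvd_zero _

/-- Both factors have leading coefficients of degree at most their own degree; equality for the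
product forces equality for each. -/
theorem natDegree_leadingCoeff_of_mul {P Q : Polynomial (Polynomial ℂ)} {d : ℕ} (hd : d ≠ 0)
    (hP : ∀ i, (P.coeff i).natDegree ≤ i) (hQ : ∀ i, (Q.coeff i).natDegree ≤ i)
    (hPQ : (P * Q).natDegree ≤ d) (htop : ((P * Q).coeff d).natDegree = d) :
    P.leadingCoeff.natDegree = P.natDegree := by
  have hne : (P * Q).coeff d ≠ 0 := by
    intro h
    rw [h, natDegree_zero] at htop
    exact hd htop.symm
  have hdeg : (P * Q).natDegree = d := le_antisymm hPQ (le_natDegree_of_ne_zero hne)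
  have hPQ0 : P * Q ≠ 0 := by
    intro h
    simp [h] at hne
  have hP0 := left_ne_zero_of_mul hPQ0
  have hQ0 := right_ne_zero_of_mul hPQ0
  have h1 : (P * Q).leadingCoeff.natDegree = d := by rw [leadingCoeff, hdeg, htop]
  rw [leadingCoeff_mul, natDegree_mul (leadingCoeff_ne_zero.2 hP0) (leadingCoeff_ne_zero.2 hQ0)]
    at h1
  rw [natDegree_mul hP0 hQ0] at hdeg
  have h2 := hP P.natDegree
  have h3 := hQ Q.natDegree
  rw [coeff_natDegree] at h2 h3
  omega

end Polynomial

/-! ### Zeros of the factors `G_j` with prescribed coordinates. -/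

section Cartesian

open MvPolynomial

variable {k d : ℕ} {n : Fin k → ℕ} {F : BlockPolynomial n} {G : ∀ j, MvPolynomial (Fin (n j)) ℂ}
  {H : Fin k → BlockPolynomial n}

theorem aeval_eq_block_mul {K : Type*} [CommRing K] [Algebra ℂ K]
    (hF : F = ∑ j, rename (Sigma.mk j) (G j) * H j) (j : Fin k) (φ : (Σ j : Fin k, Fin (n j)) → K)
    (hφ : ∀ i ≠ j, aeval (fun l => φ ⟨i, l⟩) (G i) = 0) :
    aeval φ F = aeval (fun l => φ ⟨j, l⟩) (G j) * aeval φ (H j) := by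
  rw [hF, map_sum, Finset.sum_eq_single j]
  · rw [map_mul, aeval_rename]; rfl
  · intro i _ hi
    rw [map_mul, aeval_rename]
    exact (congrArg (· * _) (hφ i hi)).trans (zero_mul _)
  · simp

theorem alongLine_eq_block_mul {R : Type*} [CommRing R] [Algebra ℂ R]
    (hF : F = ∑ j, rename (Sigma.mk j) (G j) * H j) (j : Fin k)
    (a b : (Σ j : Fin k, Fin (n j)) → R) (ha : ∀ i ≠ j, ∀ l, a ⟨i, l⟩ = 0)
    (hb : ∀ i ≠ j, aeval (fun l => b ⟨i, l⟩) (G i) = 0) :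
    alongLine ℂ a b F =
      alongLine ℂ (fun l => a ⟨j, l⟩) (fun l => b ⟨j, l⟩) (G j) * alongLine ℂ a b (H j) := by
  refine aeval_eq_block_mul hF j _ fun i hi => ?_
  have h := alongLine_zero (K := ℂ) (fun l => b ⟨i, l⟩) (G i)
  rw [hb i hi, map_zero] at h
  rw [← h, alongLine]
  congr 2
  ext1 l
  simp [ha i hi l]

theorem aeval_algebraMap_eq_zero {σ R : Type*} [CommRing R] [Algebra ℂ R] {z : σ → ℂ}
    {P : MvPolynomial σ ℂ} (h : eval z P = 0) : aeval (fun l => algebraMap ℂ R (z l)) P = 0 := by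
  have := aeval_algebraMap_apply (R := ℂ) (A := ℂ) R z P
  rw [aeval_eq_eval] at this
  exact this.trans (by rw [h, map_zero])

/-- Along the direction of `x_{j,i}`, the leading coefficient of `G_j` divides the nonzero constant
coefficient of the pure power in `F`; hence it is a unit and survives specialization to `u`. -/
theorem exists_update_root (hF : F = ∑ j, rename (Sigma.mk j) (G j) * H j)
    (hd : F.totalDegree ≤ d) {z : ∀ j, Fin (n j) → ℂ} (hz : ∀ j, eval (z j) (G j) = 0) (j : Fin k)
    (hG : ∀ c, G j ≠ C c) (i : Fin (n j)) (hc : coeff (Finsupp.single ⟨j, i⟩ d) F ≠ 0)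
    (u : Fin (n j) → ℂ) : ∃ t, eval (Function.update u i t) (G j) = 0 := by
  -- The line runs through the generic point of block `j`, over the polynomial ring of that block,
  -- with the zeros `z` in the other blocks.
  let a : (Σ j : Fin k, Fin (n j)) → MvPolynomial (Fin (n j)) ℂ := Pi.single ⟨j, i⟩ 1
  let B : ∀ i', Fin (n i') → MvPolynomial (Fin (n j)) ℂ :=
    Function.update (fun i' l => C (z i' l)) j (Function.update X i 0)
  let b : (Σ j : Fin k, Fin (n j)) → MvPolynomial (Fin (n j)) ℂ := fun x => B x.1 x.2
  have hprod := alongLine_eq_block_mul hF j a b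
    (fun i' hi' l => Pi.single_eq_of_ne (fun h => hi' (congrArg Sigma.fst h)) _)
    (fun i' hi' => by
      simp only [b, B, Function.update_of_ne hi']
      exact aeval_algebraMap_eq_zero (hz i'))
  set P := alongLine ℂ (fun l => a ⟨j, l⟩) (fun l => b ⟨j, l⟩) (G j) with hP
  have hcoeff : (alongLine ℂ a b F).coeff d = C (coeff (Finsupp.single ⟨j, i⟩ d) F) := by
    rw [coeff_alongLine a b hd]
    exact aeval_homogeneousComponent_single a ⟨j, i⟩ (Pi.single_eq_same _ _)
      (fun y hy => Pi.single_eq_of_ne hy _) d F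
  have hunit : IsUnit P.leadingCoeff := by
    have h := Polynomial.leadingCoeff_dvd_coeff (Dvd.intro _ hprod.symm)
      (natDegree_alongLine_le a b hd)
    rw [hcoeff] at h
    exact isUnit_of_dvd_unit h ((isUnit_iff_ne_zero.2 hc).map C)
  have hline : ∀ v : Fin (n j) → MvPolynomial (Fin (n j)) ℂ,
      (fun l => b ⟨j, l⟩ + a ⟨j, l⟩ * v i) = Function.update X i (v i) := by
    intro v
    ext1 l
    by_cases hl : l = i
    · subst hl; simp [a, b, B]
    · have : (⟨j, l⟩ : Σ j : Fin k, Fin (n j)) ≠ ⟨j, i⟩ := by simpa using hl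
      simp [a, b, B, hl]
  -- Evaluating `P` at the variable `X i` recovers `G j`, so degree 0 would make `G j` constant.
  have hdeg : P.natDegree ≠ 0 := by
    intro h0
    obtain ⟨c, -, hc'⟩ := isUnit_iff_eq_C_of_isReduced.1 hunit
    refine hG c ?_
    have h1 := eval_alongLine (K := ℂ) (fun l => a ⟨j, l⟩) (fun l => b ⟨j, l⟩) (X i) (G j)
    rw [hline X, Function.update_eq_self, aeval_X_left_apply, ← hP,
      Polynomial.eq_C_of_natDegree_eq_zero h0, Polynomial.eval_C] at h1
    rw [← h1, ← hc', Polynomial.leadingCoeff, h0]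
  have hdeg' : (P.map ((aeval u : MvPolynomial (Fin (n j)) ℂ →ₐ[ℂ] ℂ) :
      MvPolynomial (Fin (n j)) ℂ →+* ℂ)).degree ≠ 0 := by
    intro h
    rw [Polynomial.degree_map_eq_of_leadingCoeff_ne_zero] at h
    · exact hdeg (Polynomial.natDegree_eq_of_degree_eq_some h)
    · exact (hunit.map _).ne_zero
  obtain ⟨t, ht⟩ := IsAlgClosed.exists_root _ hdeg'
  refine ⟨t, ?_⟩
  rw [Polynomial.IsRoot, hP, map_alongLine, eval_alongLine] at ht
  rw [← ht, ← aeval_eq_eval]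
  congr 2
  ext1 l
  by_cases hl : l = i
  · subst hl; simp [a, b, B]
  · have : (⟨j, l⟩ : Σ j : Fin k, Fin (n j)) ≠ ⟨j, i⟩ := by simpa using hl
    simp [a, b, B, hl]

end Cartesian

/-! ### What being Cartesian imposes on the top form. -/

section Cartesian

open MvPolynomial

variable {k d : ℕ} {n : Fin k → ℕ} {F : BlockPolynomial n}

theorem slopeVector_block {R : Type*} [CommRing R] {j : Fin k} (i i' : Fin (n j)) (r : R)
    (l : Fin (n j)) : slopeVector (σ := Σ j : Fin k, Fin (n j)) ⟨j, i⟩ ⟨j, i'⟩ r ⟨j, l⟩ =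
      slopeVector i i' r l := by
  simp [slopeVector, Pi.single_apply]

theorem slopeVector_block_of_ne {R : Type*} [CommRing R] {j j' : Fin k} (h : j' ≠ j)
    (i i' : Fin (n j)) (r : R) (l : Fin (n j')) :
    slopeVector (σ := Σ j : Fin k, Fin (n j)) ⟨j, i⟩ ⟨j, i'⟩ r ⟨j', l⟩ = 0 := by
  simp [slopeVector, h]

theorem sum_add_single_mul {σ R : Type*} [Fintype σ] [DecidableEq σ] [CommRing R] (c v : σ → R)
    (p q : σ) (r s : R) :
    ∑ i, (c + Pi.single p r + Pi.single q s : σ → R) i * v i = ∑ i, c i * v i + r * v p + s * v q := by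
  simp only [Pi.add_apply, add_mul, Finset.sum_add_distrib]
  congr 2
  · rw [Finset.sum_eq_single p (fun i _ hi => by simp [hi]) (by simp), Pi.single_eq_same]
  · rw [Finset.sum_eq_single q (fun i _ hi => by simp [hi]) (by simp), Pi.single_eq_same]

/-- The top form of a Cartesian polynomial vanishes at a point `a` of the block `j` and, unless a
derivative in the direction of the block `j'` vanishes as well, at a point of the block `j'` that
is determined by `a`. -/
theorem IsCartesian.exists_slopes (hF : IsCartesian F) (hd : F.totalDegree ≤ d + 1) {j j' : Fin k}
    (hj : j ≠ j') {i₀ i₁ : Fin (n j)} (hi : i₀ ≠ i₁) {l₀ l₁ : Fin (n j')} (hl : l₀ ≠ l₁)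
    (hc : coeff (Finsupp.single ⟨j, i₀⟩ (d + 1)) F ≠ 0)
    (hc' : coeff (Finsupp.single ⟨j', l₀⟩ (d + 1)) F ≠ 0) :
    ∃ α : ℂ, eval (slopeVector ⟨j, i₀⟩ ⟨j, i₁⟩ α) (homogeneousComponent (d + 1) F) = 0 ∧
      (eval (slopeVector ⟨j, i₀⟩ ⟨j, i₁⟩ α)
          (pderiv ⟨j', l₀⟩ (homogeneousComponent (d + 1) F)) = 0 ∨
        ∃ δ : ℂ, δ * eval (slopeVector ⟨j, i₀⟩ ⟨j, i₁⟩ α)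
            (pderiv ⟨j', l₀⟩ (homogeneousComponent (d + 1) F)) +
          eval (slopeVector ⟨j, i₀⟩ ⟨j, i₁⟩ α)
            (pderiv ⟨j', l₁⟩ (homogeneousComponent (d + 1) F)) = 0 ∧
          eval (slopeVector ⟨j', l₀⟩ ⟨j', l₁⟩ δ) (homogeneousComponent (d + 1) F) = 0) := by
  obtain ⟨G, H, hG, hsum⟩ := hF
  choose z hz using fun j => exists_eval_eq_zero (hG j)
  obtain ⟨t₀, ht₀⟩ := exists_update_root hsum hd hz j (hG j) i₀ hc (Pi.single i₁ 1)
  -- A zero of `G j'` for each value `s` of the `l₁`-coordinate; no regularity of `β` is known yet.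
  choose β hβ using fun s : ℂ =>
    exists_update_root hsum hd hz j' (hG j') l₀ hc' (Pi.single l₁ s)
  have hβ' : ∀ s, eval (Pi.single l₀ (β s) + Pi.single l₁ s) (G j') = 0 := by
    intro s
    rw [← hβ s]
    congr 2
    ext1 l
    by_cases h : l = l₀
    · subst h; simp [hl]
    · simp [h]
  have ht₀' : eval (slopeVector i₀ i₁ t₀) (G j) = 0 := by
    rw [← ht₀]
    congr 2
    ext1 l
    by_cases h : l = i₀
    · subst h; simp [slopeVector, hi]
    · simp [slopeVector, h]
  set T := homogeneousComponent (d + 1) F with hT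
  let a : (Σ j : Fin k, Fin (n j)) → Polynomial ℂ := slopeVector ⟨j, i₀⟩ ⟨j, i₁⟩ Polynomial.X
  let c : (Σ j : Fin k, Fin (n j)) → ℂ :=
    fun x => Function.update (Function.update z j 0) j' 0 x.1 x.2
  let b : ℂ → (Σ j : Fin k, Fin (n j)) → ℂ :=
    fun s => c + Pi.single ⟨j', l₀⟩ (β s) + Pi.single ⟨j', l₁⟩ s
  have hbj : ∀ s l, b s ⟨j, l⟩ = 0 := by
    intro s l
    simp [b, c, hj]
  have hbj' : ∀ s, (fun l => b s ⟨j', l⟩) = Pi.single l₀ (β s) + Pi.single l₁ s := by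
    intro s
    ext1 l
    simp [b, c, Pi.single_apply]
  have hb : ∀ s, ∀ i ≠ j, i ≠ j' → (fun l => b s ⟨i, l⟩) = z i := by
    intro s i h h'
    ext1 l
    simp [b, c, h, h']
  have hbz : ∀ s, ∀ i ≠ j, eval (fun l => b s ⟨i, l⟩) (G i) = 0 := by
    intro s i h
    by_cases h' : i = j'
    · subst h'
      rw [hbj', hβ']
    · rw [hb s i h h', hz]
  -- The base point is zero in block `j` for every `s`, so this divisor does not depend on `s`.
  set P : Polynomial (Polynomial ℂ) :=
    alongLine ℂ (slopeVector i₀ i₁ Polynomial.X) (fun _ => Polynomial.C 0) (G j) with hP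
  have hprod : ∀ s, alongLine ℂ a (fun x => Polynomial.C (b s x)) F =
      P * alongLine ℂ a (fun x => Polynomial.C (b s x)) (H j) := by
    intro s
    have h := alongLine_eq_block_mul hsum j a (fun x => Polynomial.C (b s x))
      (fun i h l => slopeVector_block_of_ne h _ _ _ _)
      (fun i h => aeval_algebraMap_eq_zero (hbz s i h))
    have h1 : (fun l => a ⟨j, l⟩) = slopeVector i₀ i₁ Polynomial.X :=
      funext fun l => slopeVector_block _ _ _ _
    simp only [hbj] at h
    rw [h1] at h
    exact h
  have hslope : ∀ {σ : Type} [DecidableEq σ] (p q : σ) (i : σ), p ≠ q →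
      (slopeVector p q (Polynomial.X : Polynomial ℂ) i).natDegree ≤ 1 := by
    intro σ _ p q i hpq
    simp only [slopeVector, Pi.add_apply, Pi.single_apply]
    refine Polynomial.natDegree_add_le_of_degree_le ?_ ?_ <;> split_ifs <;> simp
  have hne : (⟨j, i₀⟩ : Σ j : Fin k, Fin (n j)) ≠ ⟨j, i₁⟩ := by simpa using hi
  have hΦ : ∀ s, (alongLine ℂ a (fun x => Polynomial.C (b s x)) F).coeff (d + 1) = aeval a T :=
    fun s => coeff_alongLine _ _ hd
  have hTdeg : T.totalDegree ≤ d + 1 := (homogeneousComponent_isHomogeneous _ _).totalDegree_le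
  -- The coefficient of `X ^ (d + 1)` is that of the pure power of `x_{j,i₀}`, nonzero by `hc`.
  have hΦdeg : (aeval a T).natDegree = d + 1 := by
    have hTT : homogeneousComponent (d + 1) T = T :=
      homogeneousComponent_eq_self (homogeneousComponent_isHomogeneous _ _)
    simp only [a]
    rw [aeval_slopeVector_X]
    refine le_antisymm (natDegree_alongLine_le _ _ hTdeg) (Polynomial.le_natDegree_of_ne_zero ?_)
    rw [coeff_alongLine _ _ hTdeg, hTT, aeval_homogeneousComponent_single _ ⟨j, i₀⟩
      (Pi.single_eq_same _ _) (fun y hy => Pi.single_eq_of_ne hy _)]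
    exact hc
  have hlead : P.leadingCoeff.natDegree = P.natDegree := by
    refine Polynomial.natDegree_leadingCoeff_of_mul (Nat.succ_ne_zero d)
      (natDegree_coeff_alongLine_le _ _ (fun i => hslope _ _ i hi) _)
      (natDegree_coeff_alongLine_le a (b 0) (fun i => hslope _ _ i hne) (H j)) ?_ ?_
    · rw [← hprod]
      exact natDegree_alongLine_le _ _ hd
    · rw [← hprod, hΦ, hΦdeg]
  -- Otherwise `G j` is constant on the plane; vanishing at `(t₀, 1)`, it would be zero there, and
  -- so would the top form.
  have hP0 : P.natDegree ≠ 0 := by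
    intro h0
    have hPC := Polynomial.eq_C_of_natDegree_eq_zero h0
    have hPC' := Polynomial.eq_C_of_natDegree_le_zero
      (natDegree_coeff_alongLine_le _ (fun _ => (0 : ℂ)) (fun i => hslope _ _ i hi) (G j) 0)
    rw [← hP] at hPC'
    have h1 : P.eval 1 = aeval (slopeVector i₀ i₁ Polynomial.X) (G j) := by
      rw [hP, eval_alongLine]
      congr 2
      ext1 l
      simp
    have h2 := eval_aeval_slopeVector_X i₀ i₁ t₀ (G j)
    rw [← h1, ht₀', hPC, Polynomial.eval_C, hPC', Polynomial.eval_C] at h2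
    have h3 : P = 0 := by rw [hPC, hPC', h2, map_zero, map_zero]
    have h4 := hΦ 0
    rw [hprod, h3, zero_mul, Polynomial.coeff_zero] at h4
    rw [← h4, Polynomial.natDegree_zero] at hΦdeg
    omega
  obtain ⟨α, hα⟩ := IsAlgClosed.exists_root P.leadingCoeff (fun h =>
    hP0 (hlead ▸ Polynomial.natDegree_eq_of_degree_eq_some h))
  have hroot : ∀ D : Polynomial (Polynomial ℂ), ∀ m, P ∣ D → D.natDegree ≤ m →
      (D.coeff m).eval α = 0 := by
    intro D m h hm
    exact hα.dvd (Polynomial.leadingCoeff_dvd_coeff h hm)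
  have hαT : eval (slopeVector ⟨j, i₀⟩ ⟨j, i₁⟩ α) T = 0 := by
    have := hroot _ (d + 1) (Dvd.intro _ (hprod 0).symm) (natDegree_alongLine_le _ _ hd)
    rwa [hΦ, eval_aeval_slopeVector_X] at this
  -- Subtracting the restrictions at `s` and `0` cancels the coefficient of degree `d + 1`. The next
  -- one is a directional derivative of the top form, and `P.leadingCoeff` divides it.
  have hlin : ∀ s, (β s - β 0) * eval (slopeVector ⟨j, i₀⟩ ⟨j, i₁⟩ α) (pderiv ⟨j', l₀⟩ T) +
      s * eval (slopeVector ⟨j, i₀⟩ ⟨j, i₁⟩ α) (pderiv ⟨j', l₁⟩ T) = 0 := by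
    intro s
    have hdeg : (alongLine ℂ a (fun x => Polynomial.C (b s x)) F -
        alongLine ℂ a (fun x => Polynomial.C (b 0 x)) F).natDegree ≤ d := by
      refine Polynomial.natDegree_le_iff_coeff_eq_zero.2 fun N hN => ?_
      rw [Polynomial.coeff_sub]
      rcases (Nat.succ_le_of_lt hN).eq_or_lt with rfl | hlt
      · exact sub_eq_zero.2 ((hΦ s).trans (hΦ 0).symm)
      · rw [Polynomial.coeff_eq_zero_of_natDegree_lt
            ((natDegree_alongLine_le _ _ hd).trans_lt hlt),
          Polynomial.coeff_eq_zero_of_natDegree_lt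
            ((natDegree_alongLine_le _ _ hd).trans_lt hlt), sub_zero]
    have := hroot _ d (dvd_sub (Dvd.intro _ (hprod s).symm) (Dvd.intro _ (hprod 0).symm)) hdeg
    rw [Polynomial.coeff_sub, coeff_alongLine_of_succ _ _ hd, coeff_alongLine_of_succ _ _ hd,
      add_sub_add_left_eq_sub, Polynomial.eval_sub, Polynomial.eval_finsetSum,
      Polynomial.eval_finsetSum] at this
    simp only [Polynomial.eval_mul, Polynomial.eval_C, a, eval_aeval_slopeVector_X, b,
      sum_add_single_mul, ← hT] at this
    linear_combination this
  refine ⟨α, hαT, or_iff_not_imp_left.2 fun hL => ?_⟩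
  set L₀ := eval (slopeVector ⟨j, i₀⟩ ⟨j, i₁⟩ α) (pderiv ⟨j', l₀⟩ T)
  set L₁ := eval (slopeVector ⟨j, i₀⟩ ⟨j, i₁⟩ α) (pderiv ⟨j', l₁⟩ T)
  refine ⟨-L₁ / L₀, by field_simp; ring, ?_⟩
  have hβlin : ∀ s, β s = β 0 + -L₁ / L₀ * s := by
    intro s
    have := hlin s
    field_simp
    linear_combination this
  set δ := -L₁ / L₀
  let b' : (Σ j : Fin k, Fin (n j)) → ℂ :=
    fun x => Function.update z j' (Pi.single l₀ (β 0)) x.1 x.2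
  -- Since `β` is affine, `G j'` vanishes on a whole line of slope `δ`, and `F` with it.
  have hzero : alongLine ℂ (slopeVector ⟨j', l₀⟩ ⟨j', l₁⟩ δ) b' F = 0 := by
    refine Polynomial.funext fun s => ?_
    rw [eval_alongLine, aeval_eq_block_mul hsum j', Polynomial.eval_zero]
    · refine mul_eq_zero_of_left ?_ _
      rw [aeval_eq_eval, ← hβ' s]
      congr 2
      ext1 l
      simp only [slopeVector_block, b', Function.update_self]
      simp only [slopeVector, Pi.add_apply]
      rw [hβlin s]
      simp only [Pi.single_apply]
      split_ifs <;> ring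
    · intro i h
      rw [aeval_eq_eval, ← hz i]
      congr 2
      ext1 l
      simp [b', h, slopeVector_block_of_ne h]
  have := coeff_alongLine (slopeVector ⟨j', l₀⟩ ⟨j', l₁⟩ δ) b' hd
  rw [hzero, Polynomial.coeff_zero, aeval_eq_eval] at this
  exact this.symm

end Cartesian

/-! ### Hypersurfaces in coefficient space. -/

namespace MvPolynomial

section TopForm

variable {σ R : Type*} [CommRing R] [Algebra ℂ R]

theorem homogeneousComponent_monomial_single (x : σ) (d : ℕ) :
    homogeneousComponent d (monomial (Finsupp.single x d) (1 : ℂ)) = X x ^ d := by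
  rw [homogeneousComponent_monomial_self _ _ (Finsupp.degree_single _ _), X_pow_eq_monomial]

theorem homogeneousComponent_monomial_single_add_single (x y : σ) (d : ℕ) :
    homogeneousComponent (d + 1) (monomial (Finsupp.single x d + Finsupp.single y 1) (1 : ℂ)) =
      X x ^ d * X y := by
  rw [homogeneousComponent_monomial_self _ _ (by simp), X_pow_eq_monomial, X, monomial_mul,
    one_mul]

/-- The value at `a` of the form of degree `d` of a polynomial. -/
noncomputable def formValue (d : ℕ) (a : σ → R) : MvPolynomial σ ℂ →ₗ[ℂ] R :=
  (aeval a).toLinearMap ∘ₗ homogeneousComponent d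

/-- The value at `a` of a partial derivative of the form of degree `d` of a polynomial. -/
noncomputable def formDeriv (d : ℕ) (a : σ → R) (y : σ) : MvPolynomial σ ℂ →ₗ[ℂ] R :=
  (aeval a).toLinearMap ∘ₗ (pderiv y).toLinearMap ∘ₗ homogeneousComponent d

theorem formValue_apply (d : ℕ) (a : σ → R) (F : MvPolynomial σ ℂ) :
    formValue d a F = aeval a (homogeneousComponent d F) := rfl

theorem formDeriv_apply (d : ℕ) (a : σ → R) (y : σ) (F : MvPolynomial σ ℂ) :
    formDeriv d a y F = aeval a (pderiv y (homogeneousComponent d F)) := rfl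

theorem formValue_single (d : ℕ) (a : σ → R) (x : σ) :
    formValue d a (monomial (Finsupp.single x d) 1) = a x ^ d := by
  rw [formValue_apply, homogeneousComponent_monomial_single, map_pow, aeval_X]

theorem formValue_single_add_single (d : ℕ) (a : σ → R) (x y : σ) :
    formValue (d + 1) a (monomial (Finsupp.single x d + Finsupp.single y 1) 1) = a x ^ d * a y := by
  rw [formValue_apply, homogeneousComponent_monomial_single_add_single, map_mul, map_pow, aeval_X,
    aeval_X]

theorem formDeriv_single_self (d : ℕ) (a : σ → R) (x : σ) :
    formDeriv (d + 1) a x (monomial (Finsupp.single x (d + 1)) 1) = (d + 1) * a x ^ d := by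
  rw [formDeriv_apply, homogeneousComponent_monomial_single, pderiv_pow, pderiv_X_self]
  simp

theorem formDeriv_single_of_ne (d : ℕ) (a : σ → R) {x y : σ} (h : x ≠ y) :
    formDeriv d a y (monomial (Finsupp.single x d) 1) = 0 := by
  rw [formDeriv_apply, homogeneousComponent_monomial_single, pderiv_pow, pderiv_X_of_ne h]
  simp

theorem formDeriv_single_add_single_self (d : ℕ) (a : σ → R) {x y : σ} (h : x ≠ y) :
    formDeriv (d + 1) a y (monomial (Finsupp.single x d + Finsupp.single y 1) 1) = a x ^ d := by
  rw [formDeriv_apply, homogeneousComponent_monomial_single_add_single, pderiv_mul, pderiv_pow,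
    pderiv_X_of_ne h, pderiv_X_self]
  simp

theorem formDeriv_single_add_single_of_ne (d : ℕ) (a : σ → R) {x y w : σ} (h : x ≠ w)
    (h' : y ≠ w) :
    formDeriv (d + 1) a w (monomial (Finsupp.single x d + Finsupp.single y 1) 1) = 0 := by
  rw [formDeriv_apply, homogeneousComponent_monomial_single_add_single, pderiv_mul, pderiv_pow,
    pderiv_X_of_ne h, pderiv_X_of_ne h']
  simp

end TopForm

theorem slopeVector_right {σ R : Type*} [CommRing R] [DecidableEq σ] {p q : σ} (h : p ≠ q)
    (r : R) : slopeVector p q r q = 1 := by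
  simp [slopeVector, h.symm]

theorem slopeVector_of_ne {σ R : Type*} [CommRing R] [DecidableEq σ] {p q i : σ} (h : i ≠ p)
    (h' : i ≠ q) (r : R) : slopeVector p q r i = 0 := by
  simp [slopeVector, h, h']

theorem eval_aeval_slopeVector {σ : Type*} [DecidableEq σ] {τ : Type*} (t : τ → ℂ) (p q : σ) (i : τ) (F : MvPolynomial σ ℂ) :
    eval t (aeval (slopeVector p q (X i : MvPolynomial τ ℂ)) F) =
      eval (slopeVector p q (t i)) F := by
  simp only [← aeval_eq_eval]
  rw [← AlgHom.comp_apply, comp_aeval]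
  congr 2
  ext1 l
  simp only [slopeVector, Pi.add_apply, Pi.single_apply]
  split_ifs <;> simp

variable {σ : Type} [Finite σ] [DecidableEq σ]

/-- Two conditions against the one parameter `α`. At the slope vector `x₁` is 1 and `y` is 0, so the
monomials `x₁^(d+1)` and `x₁^d y` isolate them. -/
theorem exists_hypersurface_common_zero_deriv (d : ℕ) {x₀ x₁ y : σ} (hx : x₀ ≠ x₁)
    (hy₀ : y ≠ x₀) (hy₁ : y ≠ x₁) :
    ∃ R : MvPolynomial {m : σ →₀ ℕ // m.degree ≤ d + 1} ℂ, R ≠ 0 ∧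
      ∀ F : MvPolynomial σ ℂ, F.totalDegree ≤ d + 1 → ∀ α : ℂ,
        eval (slopeVector x₀ x₁ α) (homogeneousComponent (d + 1) F) = 0 →
        eval (slopeVector x₀ x₁ α) (pderiv y (homogeneousComponent (d + 1) F)) = 0 →
        eval (coeffVector (d + 1) F) R = 0 := by
  let a : σ → MvPolynomial Unit ℂ := slopeVector x₀ x₁ (X ())
  have ha : a x₁ = 1 := slopeVector_right hx _
  have ha' : a y = 0 := slopeVector_of_ne hy₀ hy₁ _
  obtain ⟨R, hR, h⟩ := exists_ne_zero_eval_coeffVector_eq_zero (σ := σ) (d + 1)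
    (show Fintype.card Unit < Fintype.card (Fin 2) by simp)
    ![formValue (d + 1) a, formDeriv (d + 1) a y]
    ![Finsupp.single x₁ (d + 1), Finsupp.single x₁ d + Finsupp.single y 1]
    (by intro s; fin_cases s <;> simp)
    (by
      intro s s'
      fin_cases s <;> fin_cases s' <;>
        simp [-Finsupp.single_add, formValue_single, formValue_single_add_single, formDeriv_single_of_ne _ _ hy₁.symm,
          formDeriv_single_add_single_self _ _ hy₁.symm, ha, ha'])
  refine ⟨R, hR, fun F hF α h1 h2 => h F hF (fun _ => α) fun s => ?_⟩
  fin_cases s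
  · exact (eval_aeval_slopeVector _ _ _ _ _).trans h1
  · exact (eval_aeval_slopeVector _ _ _ _ _).trans h2

/-- Three conditions against the two parameters `α`, `δ`, isolated by `x₁^(d+1)`, `x₁^d y₁` and
`y₁^(d+1)`. The off-diagonal entries involve `0 ^ d`, whence `d ≠ 0`. -/
theorem exists_hypersurface_linked_zeros {d : ℕ} (hd : d ≠ 0) {x₀ x₁ y₀ y₁ : σ} (hx : x₀ ≠ x₁)
    (hy : y₀ ≠ y₁) (h₀₁ : x₀ ≠ y₁) (h₁₀ : x₁ ≠ y₀) (h₁₁ : x₁ ≠ y₁) :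
    ∃ R : MvPolynomial {m : σ →₀ ℕ // m.degree ≤ d + 1} ℂ, R ≠ 0 ∧
      ∀ F : MvPolynomial σ ℂ, F.totalDegree ≤ d + 1 → ∀ α δ : ℂ,
        eval (slopeVector x₀ x₁ α) (homogeneousComponent (d + 1) F) = 0 →
        δ * eval (slopeVector x₀ x₁ α) (pderiv y₀ (homogeneousComponent (d + 1) F)) +
          eval (slopeVector x₀ x₁ α) (pderiv y₁ (homogeneousComponent (d + 1) F)) = 0 →
        eval (slopeVector y₀ y₁ δ) (homogeneousComponent (d + 1) F) = 0 →
        eval (coeffVector (d + 1) F) R = 0 := by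
  let a : σ → MvPolynomial (Fin 2) ℂ := slopeVector x₀ x₁ (X 0)
  let b : σ → MvPolynomial (Fin 2) ℂ := slopeVector y₀ y₁ (X 1)
  have ha : a x₁ = 1 := slopeVector_right hx _
  have ha' : a y₁ = 0 := slopeVector_of_ne h₀₁.symm h₁₁.symm _
  have hb : b y₁ = 1 := slopeVector_right hy _
  have hb' : b x₁ = 0 := slopeVector_of_ne h₁₀ h₁₁ _
  let D : MvPolynomial σ ℂ →ₗ[ℂ] MvPolynomial (Fin 2) ℂ :=
    LinearMap.mulLeft ℂ (X 1) ∘ₗ formDeriv (d + 1) a y₀ + formDeriv (d + 1) a y₁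
  have hD : ∀ F, D F = X 1 * formDeriv (d + 1) a y₀ F + formDeriv (d + 1) a y₁ F := fun _ => rfl
  obtain ⟨R, hR, h⟩ := exists_ne_zero_eval_coeffVector_eq_zero (σ := σ) (d + 1)
    (show Fintype.card (Fin 2) < Fintype.card (Fin 3) by simp)
    ![formValue (d + 1) a, D, formValue (d + 1) b]
    ![Finsupp.single x₁ (d + 1), Finsupp.single x₁ d + Finsupp.single y₁ 1,
      Finsupp.single y₁ (d + 1)]
    (by intro s; fin_cases s <;> simp)
    (by
      intro s s'
      fin_cases s <;> fin_cases s' <;>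
        simp [-Finsupp.single_add, hD, formValue_single, formValue_single_add_single,
          formDeriv_single_of_ne _ _ h₁₀,
          formDeriv_single_of_ne _ _ h₁₁, formDeriv_single_of_ne _ _ hy.symm,
          formDeriv_single_self, formDeriv_single_add_single_of_ne _ _ h₁₀ hy.symm,
          formDeriv_single_add_single_self _ _ h₁₁, ha, ha', hb, hb', hd])
  refine ⟨R, hR, fun F hF α δ h1 h2 h3 => h F hF ![α, δ] fun s => ?_⟩
  fin_cases s
  · exact (eval_aeval_slopeVector _ _ _ _ _).trans h1
  · change eval ![α, δ] (D F) = 0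
    rw [hD, formDeriv_apply, formDeriv_apply, map_add, map_mul, eval_X, eval_aeval_slopeVector,
      eval_aeval_slopeVector]
    exact h2
  · exact (eval_aeval_slopeVector _ _ _ _ _).trans h3

theorem genericPolynomialSatisfies_of_eval_ne_zero {σ : Type*} {d : ℕ}
    {P : MvPolynomial σ ℂ → Prop} {R : MvPolynomial {m : σ →₀ ℕ // m.degree ≤ d} ℂ} (hR : R ≠ 0)
    (h : ∀ F : MvPolynomial σ ℂ, F.totalDegree ≤ d → eval (coeffVector d F) R ≠ 0 → P F) :
    GenericPolynomialSatisfies d P := by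
  refine ⟨{c | eval c R ≠ 0}, ⟨Ideal.span {R}, ?_⟩, ?_, h⟩
  · rw [zeroLocus_span]
    ext c
    simp [aeval_eq_eval]
  · by_contra hne
    refine hR (MvPolynomial.funext fun c => ?_)
    by_contra hc
    exact hne ⟨c, by simpa using hc⟩

end MvPolynomial

/-! ### Assembly. -/

open MvPolynomial in
theorem genericPolynomialSatisfies_not_isCartesian {k d : ℕ} {n : Fin k → ℕ} (hk : 2 ≤ k)
    (hn : ∀ j, 2 ≤ n j) (hd : 2 ≤ d) :
    GenericPolynomialSatisfies d (fun F : BlockPolynomial n => ¬ IsCartesian F) := by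
  obtain ⟨d, rfl⟩ : ∃ e, d = e + 1 := ⟨d - 1, by omega⟩
  let j : Fin k := ⟨0, by omega⟩
  let j' : Fin k := ⟨1, by omega⟩
  have hj : j ≠ j' := by simp [j, j']
  let i₀ : Fin (n j) := ⟨0, by have := hn j; omega⟩
  let i₁ : Fin (n j) := ⟨1, by have := hn j; omega⟩
  let l₀ : Fin (n j') := ⟨0, by have := hn j'; omega⟩
  let l₁ : Fin (n j') := ⟨1, by have := hn j'; omega⟩
  have hi : i₀ ≠ i₁ := by simp [i₀, i₁]
  have hl : l₀ ≠ l₁ := by simp [l₀, l₁]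
  have hne : ∀ i l, (⟨j, i⟩ : Σ j : Fin k, Fin (n j)) ≠ ⟨j', l⟩ :=
    fun i l h => hj (congrArg Sigma.fst h)
  have hx : (⟨j, i₀⟩ : Σ j : Fin k, Fin (n j)) ≠ ⟨j, i₁⟩ := by simpa using hi
  have hy : (⟨j', l₀⟩ : Σ j : Fin k, Fin (n j)) ≠ ⟨j', l₁⟩ := by simpa using hl
  obtain ⟨R, hR, hRF⟩ := exists_hypersurface_common_zero_deriv d hx (hne i₀ l₀).symm
    (hne i₁ l₀).symm
  obtain ⟨S, hS, hSF⟩ := exists_hypersurface_linked_zeros (d := d) (by omega) hx hy (hne _ _)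
    (hne _ _) (hne _ _)
  let v : (Σ j : Fin k, Fin (n j)) → {m : (Σ j : Fin k, Fin (n j)) →₀ ℕ // m.degree ≤ d + 1} :=
    fun x => ⟨Finsupp.single x (d + 1), (Finsupp.degree_single _ _).le⟩
  -- The two variables force the required pure powers to occur in `F`; `R` and `S` exclude the two
  -- alternatives for the slopes.
  refine genericPolynomialSatisfies_of_eval_ne_zero (R := X (v ⟨j, i₀⟩) * X (v ⟨j', l₀⟩) * R * S)
    (by simp [hR, hS]) fun F hF hne0 hcart => ?_
  simp only [map_mul, eval_X, mul_ne_zero_iff] at hne0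
  obtain ⟨⟨⟨hc, hc'⟩, hR0⟩, hS0⟩ := hne0
  obtain ⟨α, hα, h | ⟨δ, hδ, hδ'⟩⟩ := hcart.exists_slopes hF hj hi hl hc hc'
  · exact hR0 (hRF F hF α hα h)
  · exact hS0 (hSF F hF α δ hα hδ hδ')

theorem theorem4p1 (k : ℕ) (hk : 2 ≤ k) (n : Fin k → ℕ) (hanti : Antitone n)
    (hn : ∀ j, 2 ≤ n j) (d : ℕ) :
    (k ≤ n ⟨0, by omega⟩ → 2 ≤ d →
      GenericPolynomialSatisfies d (fun F : BlockPolynomial n => ¬ IsCartesian F)) ∧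
    (max (2 * k - 3) 7 ≤ d →
      GenericPolynomialSatisfies d (fun F : BlockPolynomial n => ¬ IsCartesian F)) :=
  ⟨fun _ hd => genericPolynomialSatisfies_not_isCartesian hk hn hd, fun hd =>
    genericPolynomialSatisfies_not_isCartesian hk hn
      (by have := (le_max_right (2 * k - 3) 7).trans hd; omega)⟩
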